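/- Let $c_0>0$. For $\alpha\in[0,1]$ put $\beta=\sqrt{1-\alpha^2}$ and let $\{\vec m_{c_0,\alpha},\vec n_{c_0,\alpha},\vec b_{c_0,\alpha}\}$ be the unique solution on $\mathbb R$ of the Serret--Frenet system $$\vec m'=c\,\vec n,\qquad \vec n'=-c\,\vec m+\tau\,\vec b,\qquad \vec b'=-\tau\,\vec n,$$ with curvature $c(s)=c_0e^{-\alpha s^2/4}$, torsion $\tau(s)=\beta s/2$ and initial conditions $\vec m(0)=(1,0,0)$, $\vec n(0)=(0,1,0)$, $\vec b(0)=(0,0,1)$. Then for every $\alpha\in[0,1]$ the limit $$\vec A^+_{c_0,\alpha}=\lim_{s\to+\infty}\vec m_{c_0,\alpha}(s)$$ exists and is a unit vector of $\mathbb R^3$, the function $\alpha\mapsto \vec A^+_{c_0,\alpha}$ is continuous on $[0,1]$, and there is a constant $C(c_0)>0$, depending on $c_0$ but not on $\alpha$, such that $$|\vec A^+_{c_0,\alpha}-\vec A^+_{c_0,0}|\le C(c_0)\sqrt{\alpha}\,|\ln\alpha|\quad\text{for all }\alpha\in(0,1/2],$$ $$|\vec A^+_{c_0,\alpha}-\vec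 A^+_{c_0,1}|\le C(c_0)\sqrt{1-\alpha}\quad\text{for all }\alpha\in[1/2,1],$$ where $|\cdot|$ is the Euclidean norm. -/

import Mathlib

open Filter Topology Set

/-- Euclidean three-space. -/
abbrev E3 : Type := EuclideanSpace ℝ (Fin 3)

/-- The trihedron `{m, n, b}` solves the Serret-Frenet system with curvature `c` and torsion `τ`
on the whole line, and it is the canonical basis at `s = 0`. -/
structure IsFrenetFrame (c τ : ℝ → ℝ) (m n b : ℝ → E3) : Prop where
  deriv_m : ∀ s, HasDerivAt m (c s • n s) s
  deriv_n : ∀ s, HasDerivAt n (-(c s • m s) + τ s • b s) s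
  deriv_b : ∀ s, HasDerivAt b (-(τ s • n s)) s
  m_zero : m 0 = !₂[1, 0, 0]
  n_zero : n 0 = !₂[0, 1, 0]
  b_zero : b 0 = !₂[0, 0, 1]

/-- The curvature `c(s) = c₀ exp(-α s² / 4)`. -/
noncomputable def selfSimilarCurvature (c₀ α : ℝ) (s : ℝ) : ℝ := c₀ * Real.exp (-(α * s ^ 2 / 4))

/-- The torsion `τ(s) = β s / 2`, where `β = √(1 - α²)`. -/
noncomputable def selfSimilarTorsion (α : ℝ) (s : ℝ) : ℝ := Real.sqrt (1 - α ^ 2) * s / 2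

/-! Global existence and uniqueness for the Serret-Frenet system, one coordinate at a time:
`x = (mⱼ, nⱼ, bⱼ)` solves `x' = c P x + τ Q x` with `P`, `Q` skew-symmetric. -/

/-- The curvature part of the Serret-Frenet system. -/
noncomputable def frenetP : E3 →L[ℝ] E3 :=
  LinearMap.toContinuousLinearMap
    { toFun := fun x => !₂[x 1, -x 0, 0]
      map_add' := by intro x y; ext i; fin_cases i <;> simp [add_comm]
      map_smul' := by intro a x; ext i; fin_cases i <;> simp }

/-- The torsion part of the Serret-Frenet system. -/
noncomputable def frenetQ : E3 →L[ℝ] E3 :=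
  LinearMap.toContinuousLinearMap
    { toFun := fun x => !₂[0, x 2, -x 1]
      map_add' := by intro x y; ext i; fin_cases i <;> simp [add_comm]
      map_smul' := by intro a x; ext i; fin_cases i <;> simp }

theorem frenetP_apply (x : E3) : frenetP x = !₂[x 1, -x 0, 0] := rfl

theorem frenetQ_apply (x : E3) : frenetQ x = !₂[0, x 2, -x 1] := rfl

theorem hasDerivAt_E3 {u : ℝ → E3} {u' : E3} {s : ℝ} :
    HasDerivAt u u' s ↔ ∀ i, HasDerivAt (fun t => u t i) (u' i) s := by
  rw [hasDerivAt_iff_hasFDerivAt, ← hasFDerivWithinAt_univ, hasFDerivWithinAt_euclidean]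
  refine forall_congr' fun i => ?_
  rw [hasFDerivWithinAt_univ, hasDerivAt_iff_hasFDerivAt]
  refine Eq.to_iff (congrArg (fun A => HasFDerivAt (fun t => u t i) A s) ?_)
  ext
  simp

theorem frenet_skew (a b : ℝ) (x : E3) : inner ℝ x (a • frenetP x + b • frenetQ x) = 0 := by
  simp [PiLp.inner_apply, Fin.sum_univ_three, frenetP_apply, frenetQ_apply]
  ring

theorem frenet_norm_const {N : ℝ} (hN : 0 < N) {x x' : ℝ → E3}
    (hx : ∀ t ∈ Ioo (-N) N, HasDerivAt x (x' t) t)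
    (h0 : ∀ t ∈ Ioo (-N) N, inner ℝ (x t) (x' t) = 0) :
    ∀ t ∈ Ioo (-N) N, ‖x t‖ = ‖x 0‖ := by
  intro t ht
  have hd : ∀ t ∈ Ioo (-N) N, HasDerivAt (fun s => ‖x s‖ ^ 2) 0 t := by
    intro t ht
    have := (hx t ht).norm_sq
    rwa [h0 t ht, mul_zero] at this
  have h := isOpen_Ioo.is_const_of_deriv_eq_zero (isPreconnected_Ioo (a := -N) (b := N))
    (fun s hs => (hd s hs).differentiableAt.differentiableWithinAt)
    (fun s hs => (hd s hs).deriv) ht (show (0 : ℝ) ∈ Ioo (-N) N from ⟨by linarith, hN⟩)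
  exact (sq_eq_sq₀ (norm_nonneg _) (norm_nonneg _)).1 h

theorem frenet_local_unique {c τ : ℝ → ℝ} {N : ℝ} (hN : 0 < N) {x y : ℝ → E3}
    (hx : ∀ t ∈ Ioo (-N) N, HasDerivAt x (c t • frenetP (x t) + τ t • frenetQ (x t)) t)
    (hy : ∀ t ∈ Ioo (-N) N, HasDerivAt y (c t • frenetP (y t) + τ t • frenetQ (y t)) t)
    (h0 : x 0 = y 0) : ∀ t ∈ Ioo (-N) N, x t = y t := by
  intro t ht
  have h := frenet_norm_const hN (x := fun t => x t - y t)
    (fun t ht => (hx t ht).sub (hy t ht)) (fun t _ => by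
      have := frenet_skew (c t) (τ t) (x t - y t)
      rw [map_sub, map_sub] at this
      rw [← this]
      congr 1
      module) t ht
  simp only [h0, sub_self, norm_zero] at h
  exact sub_eq_zero.1 (norm_eq_zero.1 h)

theorem frenet_local_exists {c τ : ℝ → ℝ} (hc : Continuous c) (hτ : Continuous τ) (x₀ : E3)
    {N : ℝ} (hN : 0 < N) :
    ∃ x : ℝ → E3, x 0 = x₀ ∧
      ∀ t ∈ Ioo (-N) N, HasDerivAt x (c t • frenetP (x t) + τ t • frenetQ (x t)) t := by
  let φ : ContDiffBump (0 : E3) := ⟨‖x₀‖ + 1, ‖x₀‖ + 2, by positivity, by linarith⟩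
  have cut : ∀ A : E3 →L[ℝ] E3, ∃ K L : NNReal, LipschitzWith K (fun x => φ x • A x) ∧
      ∀ x, ‖φ x • A x‖ ≤ L := by
    intro A
    have hs : HasCompactSupport (fun x => φ x • A x) := φ.hasCompactSupport.smul_right
    have hd : ContDiff ℝ 1 (fun x => φ x • A x) := φ.contDiff.smul A.contDiff
    obtain ⟨K, hK⟩ := ContDiff.lipschitzWith_of_hasCompactSupport hs hd one_ne_zero
    obtain ⟨L, hL⟩ := hd.continuous.bounded_above_of_compact_support hs
    exact ⟨K, L.toNNReal, hK, fun x => (hL x).trans (Real.le_coe_toNNReal L)⟩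
  obtain ⟨K₁, L₁, hK₁, hL₁⟩ := cut frenetP
  obtain ⟨K₂, L₂, hK₂, hL₂⟩ := cut frenetQ
  have bdd : ∀ g : ℝ → ℝ, Continuous g → ∃ M : NNReal, ∀ t ∈ Icc (-N) N, ‖g t‖ ≤ M := by
    intro g hg
    obtain ⟨M, hM⟩ := isCompact_Icc.exists_bound_of_continuousOn (hg.continuousOn (s := Icc (-N) N))
    exact ⟨M.toNNReal, fun t ht => (hM t ht).trans (Real.le_coe_toNNReal M)⟩
  obtain ⟨M₁, hM₁⟩ := bdd c hc
  obtain ⟨M₂, hM₂⟩ := bdd τ hτ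
  let v : ℝ → E3 → E3 := fun t x => c t • (φ x • frenetP x) + τ t • (φ x • frenetQ x)
  let L : NNReal := M₁ * L₁ + M₂ * L₂
  have h0 : (0 : ℝ) ∈ Icc (-N) N := ⟨by linarith, hN.le⟩
  have hPL : IsPicardLindelof v (⟨0, h0⟩ : Icc (-N) N) x₀ (L * N.toNNReal) 0 L
      (M₁ * K₁ + M₂ * K₂) := by
    refine ⟨?_, ?_, ?_, ?_⟩
    · intro t ht
      refine LipschitzOnWith.of_dist_le_mul fun x _ y _ => ?_
      have e1 := hK₁.dist_le_mul x y
      have e2 := hK₂.dist_le_mul x y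
      calc dist (v t x) (v t y) ≤ dist (c t • (φ x • frenetP x)) (c t • (φ y • frenetP y))
            + dist (τ t • (φ x • frenetQ x)) (τ t • (φ y • frenetQ y)) := dist_add_add_le _ _ _ _
        _ = ‖c t‖ * dist (φ x • frenetP x) (φ y • frenetP y)
            + ‖τ t‖ * dist (φ x • frenetQ x) (φ y • frenetQ y) := by rw [dist_smul₀, dist_smul₀]
        _ ≤ M₁ * (K₁ * dist x y) + M₂ * (K₂ * dist x y) := by
            gcongr
            · exact hM₁ t ht
            · exact hM₂ t ht
        _ = _ := by push_cast; ring
    · intro x _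
      exact ((hc.smul continuous_const).add (hτ.smul continuous_const)).continuousOn
    · intro t ht x _
      calc ‖v t x‖ ≤ ‖c t • (φ x • frenetP x)‖ + ‖τ t • (φ x • frenetQ x)‖ := norm_add_le _ _
        _ = ‖c t‖ * ‖φ x • frenetP x‖ + ‖τ t‖ * ‖φ x • frenetQ x‖ := by
            rw [norm_smul (c t), norm_smul (τ t)]
        _ ≤ M₁ * L₁ + M₂ * L₂ := by
            gcongr
            · exact hM₁ t ht
            · exact hL₁ x
            · exact hM₂ t ht
            · exact hL₂ x
        _ = _ := by simp [L]
    · simp [Real.coe_toNNReal N hN.le]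
  obtain ⟨x, hx0, hx⟩ := hPL.exists_eq_forall_mem_Icc_hasDerivWithinAt₀
  have hx0 : x 0 = x₀ := hx0
  have hx' : ∀ t ∈ Ioo (-N) N, HasDerivAt x (v t (x t)) t := fun t ht =>
    (hx t (Ioo_subset_Icc_self ht)).hasDerivAt (Icc_mem_nhds ht.1 ht.2)
  have hv : ∀ t y, v t y = φ y • (c t • frenetP y + τ t • frenetQ y) := by
    intro t y
    simp only [v]
    module
  have hn := frenet_norm_const hN hx' (fun t _ => by
    rw [hv, inner_smul_right, frenet_skew, mul_zero])
  refine ⟨x, hx0, fun t ht => ?_⟩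
  have h1 : φ (x t) = 1 := φ.one_of_mem_closedBall (by
    rw [mem_closedBall_zero_iff, hn t ht, hx0]
    change ‖x₀‖ ≤ ‖x₀‖ + 1
    linarith)
  have := hx' t ht
  rwa [hv, h1, one_smul] at this

theorem frenet_global_exists {c τ : ℝ → ℝ} (hc : Continuous c) (hτ : Continuous τ) (x₀ : E3) :
    ∃ x : ℝ → E3, x 0 = x₀ ∧
      ∀ t, HasDerivAt x (c t • frenetP (x t) + τ t • frenetQ (x t)) t := by
  have H := fun k : ℕ => frenet_local_exists hc hτ x₀ (N := (k : ℝ) + 1) (by positivity)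
  choose X hX0 hX using H
  have key : ∀ k : ℕ, ∀ t ∈ Ioo (-((k : ℝ) + 1)) ((k : ℝ) + 1), X ⌈|t|⌉₊ t = X k t := by
    intro k t ht
    have hk : |t| < (k : ℝ) + 1 := abs_lt.2 ht
    have hj : |t| < (⌈|t|⌉₊ : ℝ) + 1 := by linarith [Nat.le_ceil |t|]
    have hmin : |t| < min ((k : ℝ) + 1) ((⌈|t|⌉₊ : ℝ) + 1) := lt_min hk hj
    refine frenet_local_unique (c := c) (τ := τ) (N := min ((k : ℝ) + 1) ((⌈|t|⌉₊ : ℝ) + 1))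
      (by positivity) (fun s hs => hX _ s ?_) (fun s hs => hX _ s ?_) ?_ t (abs_lt.1 hmin)
    · exact abs_lt.1 ((abs_lt.2 hs).trans_le (min_le_right _ _))
    · exact abs_lt.1 ((abs_lt.2 hs).trans_le (min_le_left _ _))
    · rw [hX0, hX0]
  refine ⟨fun t => X ⌈|t|⌉₊ t, hX0 _, fun t => ?_⟩
  have ht : t ∈ Ioo (-((⌈|t|⌉₊ : ℝ) + 1)) ((⌈|t|⌉₊ : ℝ) + 1) :=
    abs_lt.1 (by linarith [Nat.le_ceil |t|])
  refine (hX ⌈|t|⌉₊ t ht).congr_of_eventuallyEq ?_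
  filter_upwards [isOpen_Ioo.mem_nhds ht] with s hs using key _ s hs

/-- Existence of the Serret-Frenet trihedron for continuous curvature and torsion. -/
theorem exists_isFrenetFrame {c τ : ℝ → ℝ} (hc : Continuous c) (hτ : Continuous τ) :
    ∃ m n b : ℝ → E3, IsFrenetFrame c τ m n b := by
  obtain ⟨x, hx0, hx⟩ := frenet_global_exists hc hτ !₂[1, 0, 0]
  obtain ⟨y, hy0, hy⟩ := frenet_global_exists hc hτ !₂[0, 1, 0]
  obtain ⟨z, hz0, hz⟩ := frenet_global_exists hc hτ !₂[0, 0, 1]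
  have co : ∀ {u : ℝ → E3} {u' : E3} {s : ℝ}, HasDerivAt u u' s →
      ∀ i, HasDerivAt (fun t => u t i) (u' i) s := fun h i => hasDerivAt_E3.1 h i
  refine ⟨fun s => !₂[x s 0, y s 0, z s 0], fun s => !₂[x s 1, y s 1, z s 1],
    fun s => !₂[x s 2, y s 2, z s 2], ?_, ?_, ?_, ?_, ?_, ?_⟩
  · intro s
    refine hasDerivAt_E3.2 fun i => ?_
    fin_cases i
    · simpa [frenetP_apply, frenetQ_apply] using co (hx s) 0
    · simpa [frenetP_apply, frenetQ_apply] using co (hy s) 0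
    · simpa [frenetP_apply, frenetQ_apply] using co (hz s) 0
  · intro s
    refine hasDerivAt_E3.2 fun i => ?_
    fin_cases i
    · simpa [frenetP_apply, frenetQ_apply] using co (hx s) 1
    · simpa [frenetP_apply, frenetQ_apply] using co (hy s) 1
    · simpa [frenetP_apply, frenetQ_apply] using co (hz s) 1
  · intro s
    refine hasDerivAt_E3.2 fun i => ?_
    fin_cases i
    · simpa [frenetP_apply, frenetQ_apply] using co (hx s) 2
    · simpa [frenetP_apply, frenetQ_apply] using co (hy s) 2
    · simpa [frenetP_apply, frenetQ_apply] using co (hz s) 2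
  all_goals
    ext i
    fin_cases i <;> simp [hx0, hy0, hz0]

/-- Uniqueness of the Serret-Frenet trihedron. -/
theorem IsFrenetFrame.unique {c τ : ℝ → ℝ} {m n b m' n' b' : ℝ → E3}
    (h : IsFrenetFrame c τ m n b) (h' : IsFrenetFrame c τ m' n' b') :
    m = m' ∧ n = n' ∧ b = b' := by
  have lift : ∀ {m n b : ℝ → E3}, IsFrenetFrame c τ m n b → ∀ j s,
      HasDerivAt (fun t => (!₂[m t j, n t j, b t j] : E3))
        (c s • frenetP !₂[m s j, n s j, b s j] + τ s • frenetQ !₂[m s j, n s j, b s j]) s := by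
    intro m n b h j s
    refine hasDerivAt_E3.2 fun i => ?_
    fin_cases i
    · simpa [frenetP_apply, frenetQ_apply] using hasDerivAt_E3.1 (h.deriv_m s) j
    · simpa [frenetP_apply, frenetQ_apply] using hasDerivAt_E3.1 (h.deriv_n s) j
    · simpa [frenetP_apply, frenetQ_apply] using hasDerivAt_E3.1 (h.deriv_b s) j
  have key : ∀ j s, (!₂[m s j, n s j, b s j] : E3) = !₂[m' s j, n' s j, b' s j] := by
    intro j s
    refine frenet_local_unique (c := c) (τ := τ) (N := |s| + 1) (by positivity)
      (fun t _ => lift h j t) (fun t _ => lift h' j t) ?_ s (abs_lt.1 (by linarith))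
    simp only [h.m_zero, h.n_zero, h.b_zero, h'.m_zero, h'.n_zero, h'.b_zero]
  refine ⟨?_, ?_, ?_⟩
  · ext s j
    simpa using congrArg (fun u : E3 => u 0) (key j s)
  · ext s j
    simpa using congrArg (fun u : E3 => u 1) (key j s)
  · ext s j
    simpa using congrArg (fun u : E3 => u 2) (key j s)

theorem exists_selfSimilar_frame (c₀ α : ℝ) :
    ∃ m n b : ℝ → E3,
      IsFrenetFrame (selfSimilarCurvature c₀ α) (selfSimilarTorsion α) m n b :=
  exists_isFrenetFrame (by unfold selfSimilarCurvature; fun_prop)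
    (by unfold selfSimilarTorsion; fun_prop)

/-- The profile: the tangent vector of the (unique) Serret-Frenet trihedron with
curvature `c₀ exp(-α s² / 4)` and torsion `√(1 - α²) s / 2`. -/
noncomputable def profile (c₀ α : ℝ) : ℝ → E3 := (exists_selfSimilar_frame c₀ α).choose

theorem profile_spec (c₀ α : ℝ) :
    ∃ n b : ℝ → E3,
      IsFrenetFrame (selfSimilarCurvature c₀ α) (selfSimilarTorsion α) (profile c₀ α) n b :=
  (exists_selfSimilar_frame c₀ α).choose_spec

/-- The vector `A⁺`, the limit of the profile at `+∞`. -/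
noncomputable def limitVector (c₀ α : ℝ) : E3 := limUnder atTop (profile c₀ α)

/-! The limit exists at a rate uniform in `α`. For `α ≤ 1/2` the torsion is at least `s/4` for `s ≥
1`, and with `f = c/τ` the vector `m + f b` has derivative `f' b`, where `f` is decreasing and
`O(1/s)`; for `α ≥ 1/2` the curvature itself is integrable. Both cases give `|A⁺ - m(s)| ≤ 16 c₀/s`
(`norm_limitVector_sub_profile_le`).

Two orthonormal frames with the same initial value drift apart by at most twice the integral of the
differences of their coefficients, with no exponential factor, because the coefficient matrix is
skew (`IsMovingFrame.norm_sub_le`). Away from `α = 0` the frames are first rotated to remove the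
torsion; what is left is weighted by the Gaussian `exp(-α s²/4)`, hence integrable. This gives
continuity on `(0, 1]` and the rate at `1`, where the square root comes from `β = √(1 - α²)`.

Near `α = 0` the Gaussian gives no uniform decay. The crude comparison of frames is only `O(α s³)`,
but after two integrations by parts the corrected tangent `m + f b - g n` has a derivative whose
coefficients are `O(s⁻³)` at `α = 0` and change by `O(α)`. The corrected tangents for `α` and `0`
therefore separate at speed `O(α)`. Up to `s = 1/√α` this costs `O(√α)`, as do the corrections and
both tails there. The resulting bound `K √α` is stronger than the claimed one, since `|ln α| ≥ ln 2`
on `(0, 1/2]`. -/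

/-! ### Two consequences of the mean value inequality -/

theorem norm_sub_le_sub_of_hasDerivAt {E : Type*} [NormedAddCommGroup E] [NormedSpace ℝ E]
    {f f' : ℝ → E} {B B' : ℝ → ℝ} {a b : ℝ} (hab : a ≤ b)
    (hf : ∀ t ∈ Icc a b, HasDerivAt f (f' t) t) (hB : ∀ t ∈ Icc a b, HasDerivAt B (B' t) t)
    (hle : ∀ t ∈ Icc a b, ‖f' t‖ ≤ B' t) : ‖f b - f a‖ ≤ B b - B a := by
  refine image_norm_le_of_norm_deriv_right_le_deriv_boundary' (f := fun t => f t - f a) (f' := f')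
    (B := fun t => B t - B a) (B' := B') (a := a) (b := b) ?_ ?_ (by simp) ?_ ?_ ?_
    (right_mem_Icc.2 hab)
  · exact fun t ht => ((hf t ht).continuousAt.sub continuousAt_const).continuousWithinAt
  · exact fun t ht => ((hf t (Ico_subset_Icc_self ht)).sub_const _).hasDerivWithinAt
  · exact fun t ht => ((hB t ht).continuousAt.sub continuousAt_const).continuousWithinAt
  · exact fun t ht => ((hB t (Ico_subset_Icc_self ht)).sub_const _).hasDerivWithinAt
  · exact fun t ht => hle t (Ico_subset_Icc_self ht)

/-- If `F' ≤ 2 h √F` and `F` vanishes initially, then `√F` is at most the integral of `h`. -/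
theorem sqrt_le_sub_of_hasDerivAt {F F' B B' : ℝ → ℝ} {a b : ℝ} (hab : a ≤ b)
    (hF0 : ∀ t, 0 ≤ F t) (hFa : F a = 0)
    (hF : ∀ t ∈ Icc a b, HasDerivAt F (F' t) t) (hB : ∀ t ∈ Icc a b, HasDerivAt B (B' t) t)
    (hB0 : ∀ t ∈ Icc a b, 0 ≤ B' t)
    (hle : ∀ t ∈ Icc a b, F' t ≤ 2 * B' t * √(F t)) : √(F b) ≤ B b - B a := by
  refine le_of_forall_pos_le_add fun ε hε => ?_
  -- Adding `ε²` makes the square root differentiable where `F` vanishes; the price is the initial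
  -- value `ε`.
  have hpos : ∀ t, 0 < F t + ε ^ 2 := fun t => by have := hF0 t; positivity
  have key : √(F b + ε ^ 2) ≤ B b - B a + ε := by
    refine image_le_of_deriv_right_le_deriv_boundary (f := fun t => √(F t + ε ^ 2))
      (f' := fun t => F' t / (2 * √(F t + ε ^ 2))) (B := fun t => B t - B a + ε) (B' := B')
      (a := a) (b := b) ?_ ?_ ?_ ?_ ?_ ?_ (right_mem_Icc.2 hab)
    · exact fun t ht => (((hF t ht).add_const _).sqrt (hpos t).ne').continuousAt.continuousWithinAt
    · exact fun t ht => (((hF t (Ico_subset_Icc_self ht)).add_const _).sqrt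
        (hpos t).ne').hasDerivWithinAt
    · simp [hFa, Real.sqrt_sq hε.le]
    · exact fun t ht =>
        (((hB t ht).continuousAt.sub continuousAt_const).add continuousAt_const).continuousWithinAt
    · exact fun t ht =>
        (((hB t (Ico_subset_Icc_self ht)).sub_const _).add_const _).hasDerivWithinAt
    · intro t ht
      have ht' := Ico_subset_Icc_self ht
      rw [div_le_iff₀ (by have := Real.sqrt_pos.2 (hpos t); positivity)]
      have h1 : √(F t) ≤ √(F t + ε ^ 2) := Real.sqrt_le_sqrt (by nlinarith)
      nlinarith [hle t ht', mul_le_mul_of_nonneg_left h1 (hB0 t ht')]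
  exact (Real.sqrt_le_sqrt (by nlinarith)).trans key

/-! ### Moving frames -/

/-- An orthonormal frame driven by a general skew-symmetric matrix of coefficients, equal to the
canonical basis at `0`. -/
structure IsMovingFrame (a d τ : ℝ → ℝ) (m n b : ℝ → E3) : Prop where
  deriv_m : ∀ s, HasDerivAt m (a s • n s + d s • b s) s
  deriv_n : ∀ s, HasDerivAt n (-(a s • m s) + τ s • b s) s
  deriv_b : ∀ s, HasDerivAt b (-(d s • m s) - τ s • n s) s
  m_zero : m 0 = !₂[1, 0, 0]
  n_zero : n 0 = !₂[0, 1, 0]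
  b_zero : b 0 = !₂[0, 0, 1]

theorem IsFrenetFrame.isMovingFrame {c τ : ℝ → ℝ} {m n b : ℝ → E3} (h : IsFrenetFrame c τ m n b) :
    IsMovingFrame c 0 τ m n b where
  deriv_m s := by simpa using h.deriv_m s
  deriv_n := h.deriv_n
  deriv_b s := by simpa using h.deriv_b s
  m_zero := h.m_zero
  n_zero := h.n_zero
  b_zero := h.b_zero

/-- Rotating the normal plane by an antiderivative of the torsion removes the torsion. -/
theorem IsFrenetFrame.rotate {c τ θ : ℝ → ℝ} {m n b : ℝ → E3} (h : IsFrenetFrame c τ m n b)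
    (hθ : ∀ s, HasDerivAt θ (τ s) s) (hθ0 : θ 0 = 0) :
    IsMovingFrame (fun s => c s * Real.cos (θ s)) (fun s => c s * Real.sin (θ s)) 0 m
      (fun s => Real.cos (θ s) • n s - Real.sin (θ s) • b s)
      (fun s => Real.sin (θ s) • n s + Real.cos (θ s) • b s) where
  deriv_m s := (h.deriv_m s).congr_deriv (by
    have e : c s • n s = (Real.cos (θ s) ^ 2 + Real.sin (θ s) ^ 2) • c s • n s := by
      rw [Real.cos_sq_add_sin_sq, one_smul]
    rw [e]
    module)
  deriv_n s := (((hθ s).cos.smul (h.deriv_n s)).sub ((hθ s).sin.smul (h.deriv_b s))).congr_deriv (by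
    simp only [Pi.zero_apply]
    module)
  deriv_b s := (((hθ s).sin.smul (h.deriv_n s)).add ((hθ s).cos.smul (h.deriv_b s))).congr_deriv (by
    simp only [Pi.zero_apply]
    module)
  m_zero := h.m_zero
  n_zero := by simp [hθ0, h.n_zero]
  b_zero := by simp [hθ0, h.b_zero]

namespace IsMovingFrame

variable {a d τ : ℝ → ℝ} {m n b : ℝ → E3}

/-- Let `X` have columns `m, n, b`. Then `X' = X A` with `A` skew, so each entry of `X Xᵀ` is
constant. For a square matrix `X Xᵀ = 1` forces `Xᵀ X = 1`, whose diagonal gives the norms. -/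
theorem norm_eq_one (h : IsMovingFrame a d τ m n b) (s : ℝ) :
    ‖m s‖ = 1 ∧ ‖n s‖ = 1 ∧ ‖b s‖ = 1 := by
  have row : ∀ j k, m s j * m s k + n s j * n s k + b s j * b s k
      = m 0 j * m 0 k + n 0 j * n 0 k + b 0 j * b 0 k := by
    intro j k
    have hd : ∀ t, HasDerivAt (fun t => m t j * m t k + n t j * n t k + b t j * b t k) 0 t := by
      intro t
      have hm := hasDerivAt_E3.1 (h.deriv_m t)
      have hn := hasDerivAt_E3.1 (h.deriv_n t)
      have hb := hasDerivAt_E3.1 (h.deriv_b t)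
      refine ((((hm j).mul (hm k)).add ((hn j).mul (hn k))).add
        ((hb j).mul (hb k))).congr_deriv ?_
      simp
      ring
    exact is_const_of_deriv_eq_zero (fun t => (hd t).differentiableAt) (fun t => (hd t).deriv) s 0
  let X : Matrix (Fin 3) (Fin 3) ℝ := Matrix.of fun j => ![m s j, n s j, b s j]
  have hX : X * X.transpose = 1 := by
    ext j k
    have := row j k
    rw [h.m_zero, h.n_zero, h.b_zero] at this
    fin_cases j <;> fin_cases k <;>
      simpa [X, Matrix.mul_apply, Fin.sum_univ_three] using this
  have hX' : X.transpose * X = 1 := mul_eq_one_comm.1 hX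
  have col : ∀ i, (X.transpose * X) i i = 1 := fun i => by rw [hX']; simp
  have h0 := col 0
  have h1 := col 1
  have h2 := col 2
  simp only [X, Matrix.mul_apply, Fin.sum_univ_three, Matrix.transpose_apply, Matrix.of_apply,
    Matrix.cons_val] at h0 h1 h2
  simp only [EuclideanSpace.norm_eq, Fin.sum_univ_three, Real.norm_eq_abs, sq_abs,
    Real.sqrt_eq_one]
  refine ⟨by linarith, by linarith, by linarith⟩

/-- With `D = X - X'` and coefficient matrices `A`, `A'`, the derivative of `D` is `D A + X' (A -
A')`. The first term is orthogonal to `D` by skewness, so no Grönwall factor appears. -/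
theorem norm_sub_le {a' d' τ' : ℝ → ℝ} {m' n' b' : ℝ → E3} (h : IsMovingFrame a d τ m n b)
    (h' : IsMovingFrame a' d' τ' m' n' b') {B B' : ℝ → ℝ} {T : ℝ} (hT : 0 ≤ T)
    (hB : ∀ t ∈ Icc 0 T, HasDerivAt B (B' t) t)
    (hle : ∀ t ∈ Icc 0 T, 2 * (|a t - a' t| + |d t - d' t| + |τ t - τ' t|) ≤ B' t) :
    ‖m T - m' T‖ ≤ B T - B 0 ∧ ‖n T - n' T‖ ≤ B T - B 0 ∧ ‖b T - b' T‖ ≤ B T - B 0 := by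
  set F : ℝ → ℝ := fun t => ‖m t - m' t‖ ^ 2 + ‖n t - n' t‖ ^ 2 + ‖b t - b' t‖ ^ 2 with hF
  have hF0 : ∀ t, 0 ≤ F t := fun t => by positivity
  have comp : ∀ t, ‖m t - m' t‖ ≤ √(F t) ∧ ‖n t - n' t‖ ≤ √(F t) ∧ ‖b t - b' t‖ ≤ √(F t) := by
    intro t
    refine ⟨?_, ?_, ?_⟩ <;> refine Real.le_sqrt_of_sq_le ?_ <;> simp only [hF] <;>
      nlinarith [sq_nonneg ‖m t - m' t‖, sq_nonneg ‖n t - n' t‖, sq_nonneg ‖b t - b' t‖]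
  have key : √(F T) ≤ B T - B 0 := by
    refine sqrt_le_sub_of_hasDerivAt hT hF0 ?_
      (fun t _ => ((((h.deriv_m t).sub (h'.deriv_m t)).norm_sq.add
        ((h.deriv_n t).sub (h'.deriv_n t)).norm_sq).add
        ((h.deriv_b t).sub (h'.deriv_b t)).norm_sq)) hB
      (fun t ht => le_trans (by positivity) (hle t ht)) ?_
    · simp [hF, h.m_zero, h.n_zero, h.b_zero, h'.m_zero, h'.n_zero, h'.b_zero]
    · intro t ht
      obtain ⟨um, un, ub⟩ := h'.norm_eq_one t
      obtain ⟨cm, cn, cb⟩ := comp t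
      -- Each coefficient enters two rows of the skew matrix with opposite signs; these two terms
      -- are the source of the factor 2 in `hle`.
      have bd : ∀ (k : ℝ) (u v u' v' : E3), ‖u‖ ≤ √(F t) → ‖v‖ ≤ √(F t) → ‖u'‖ = 1 → ‖v'‖ = 1 →
          k * (inner ℝ u v' - inner ℝ v u') ≤ |k| * (2 * √(F t)) := by
        intro k u v u' v' hu hv hu' hv'
        refine (le_abs_self _).trans ?_
        rw [abs_mul]
        gcongr
        have e1 := abs_real_inner_le_norm u v'
        have e2 := abs_real_inner_le_norm v u'
        have e3 := abs_sub (inner ℝ u v') (inner ℝ v u' : ℝ)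
        rw [hv'] at e1
        rw [hu'] at e2
        linarith
      have e1 := bd (a t - a' t) _ _ _ _ cm cn um un
      have e2 := bd (d t - d' t) _ _ _ _ cm cb um ub
      have e3 := bd (τ t - τ' t) _ _ _ _ cn cb un ub
      have e4 := mul_le_mul_of_nonneg_right (hle t ht) (Real.sqrt_nonneg (F t))
      simp only [inner_add_right, inner_sub_right, inner_neg_right, inner_smul_right,
        inner_sub_left, Pi.sub_apply] at e1 e2 e3 ⊢
      have s1 := real_inner_comm (m t) (n t)
      have s2 := real_inner_comm (m t) (b t)
      have s3 := real_inner_comm (n t) (b t)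
      have s4 := real_inner_comm (m' t) (n' t)
      have s5 := real_inner_comm (m' t) (b' t)
      have s6 := real_inner_comm (n' t) (b' t)
      have s7 := real_inner_comm (m t) (n' t)
      have s8 := real_inner_comm (m t) (b' t)
      have s9 := real_inner_comm (n t) (b' t)
      have t7 := real_inner_comm (m' t) (n t)
      have t8 := real_inner_comm (m' t) (b t)
      have t9 := real_inner_comm (n' t) (b t)
      simp only [s1, s2, s3, s4, s5, s6, s7, s8, s9, t7, t8, t9] at e1 e2 e3 ⊢
      linarith
  obtain ⟨cm, cn, cb⟩ := comp T
  exact ⟨cm.trans key, cn.trans key, cb.trans key⟩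

end IsMovingFrame

/-! ### The limit of the profile -/

theorem hasDerivAt_exp_neg_sq (α s : ℝ) :
    HasDerivAt (fun s => Real.exp (-(α * s ^ 2 / 4)))
      (-(α * s / 2) * Real.exp (-(α * s ^ 2 / 4))) s :=
  ((((hasDerivAt_pow 2 s).const_mul α).div_const 4).neg.exp).congr_deriv (by
    simp only [Pi.neg_apply]
    push_cast
    ring)

theorem half_le_sqrt_one_sub_sq {α : ℝ} (h0 : 0 ≤ α) (h1 : α ≤ 1 / 2) : 1 / 2 ≤ √(1 - α ^ 2) :=
  Real.le_sqrt_of_sq_le (by nlinarith)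

theorem exp_neg_sq_le_one {α : ℝ} (h0 : 0 ≤ α) (s : ℝ) : Real.exp (-(α * s ^ 2 / 4)) ≤ 1 :=
  Real.exp_le_one_iff.2 (by have : 0 ≤ α * s ^ 2 / 4 := by positivity
                            linarith)

/-- Adding the multiple `(c / τ) b` to `m` removes the oscillating term from the derivative. -/
theorem norm_sub_le_of_le_half {c₀ α : ℝ} (hc₀ : 0 < c₀) (h0 : 0 ≤ α) (h1 : α ≤ 1 / 2)
    {m n b : ℝ → E3} (h : IsFrenetFrame (selfSimilarCurvature c₀ α) (selfSimilarTorsion α) m n b)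
    {s t : ℝ} (hs : 1 ≤ s) (hst : s ≤ t) : ‖m t - m s‖ ≤ 16 * c₀ / s := by
  have hβ := half_le_sqrt_one_sub_sq h0 h1
  set β := √(1 - α ^ 2) with hβdef
  have hβ0 : 0 < β := by linarith
  set e : ℝ → ℝ := fun s => Real.exp (-(α * s ^ 2 / 4)) with he
  have e0 : ∀ s, 0 < e s := fun s => Real.exp_pos _
  set f : ℝ → ℝ := fun s => 2 * c₀ / β * (e s * s⁻¹) with hf
  set f' : ℝ → ℝ := fun s => -(2 * c₀ / β * (e s * ((s ^ 2)⁻¹ + α / 2))) with hf'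
  have pos : ∀ u ∈ Icc s t, 0 < u := fun u hu => by linarith [hu.1]
  have df : ∀ u ∈ Icc s t, HasDerivAt f (f' u) u := fun u hu => by
    have := (pos u hu).ne'
    refine (((hasDerivAt_exp_neg_sq α u).mul (hasDerivAt_inv this)).const_mul _).congr_deriv ?_
    simp only [hf', he]
    field_simp
    ring
  -- Since `f' ≤ 0`, the function `-f` is an exact majorant and the variation is `f s - f t`.
  have key := norm_sub_le_sub_of_hasDerivAt (f := fun u => m u + f u • b u)
    (f' := fun u => f' u • b u) (B := fun u => -f u) (B' := fun u => -f' u) hst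
    (fun u hu => ((h.deriv_m u).add ((df u hu).smul (h.deriv_b u))).congr_deriv (by
      have : selfSimilarCurvature c₀ α u = f u * selfSimilarTorsion α u := by
        have := (pos u hu).ne'
        simp only [selfSimilarCurvature, selfSimilarTorsion, hf, ← hβdef, he]
        field_simp
      rw [this]
      module)) (fun u hu => (df u hu).neg) (fun u hu => by
      rw [norm_smul, (h.isMovingFrame.norm_eq_one u).2.2, mul_one, Real.norm_eq_abs, abs_of_nonpos]
      simp only [hf', Left.neg_nonpos_iff]
      have := e0 u
      positivity)
  have fpos : ∀ u ∈ Icc s t, 0 ≤ f u := fun u hu => by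
    have := pos u hu
    have := e0 u
    positivity
  have bn : ∀ u ∈ Icc s t, ‖f u • b u‖ = f u := fun u hu => by
    rw [norm_smul, (h.isMovingFrame.norm_eq_one u).2.2, mul_one, Real.norm_eq_abs,
      abs_of_nonneg (fpos u hu)]
  have b1 := bn s (left_mem_Icc.2 hst)
  have b2 := bn t (right_mem_Icc.2 hst)
  have tri : ‖m t - m s‖ ≤ ‖m t + f t • b t - (m s + f s • b s)‖ + ‖f t • b t‖ + ‖f s • b s‖ := by
    calc ‖m t - m s‖ = ‖m t + f t • b t - (m s + f s • b s) - f t • b t + f s • b s‖ := by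
          congr 1
          module
      _ ≤ _ := (norm_add_le _ _).trans (by gcongr; exact norm_sub_le _ _)
  have hs0 : 0 < s := by linarith
  have fs : f s ≤ 4 * c₀ * s⁻¹ := by
    have i1 : 2 * c₀ / β ≤ 4 * c₀ := by rw [div_le_iff₀ hβ0]; nlinarith
    have i2 : e s * s⁻¹ ≤ 1 * s⁻¹ := by
      gcongr
      exact exp_neg_sq_le_one h0 s
    calc f s ≤ 4 * c₀ * (1 * s⁻¹) := by
          have := e0 s
          simp only [hf]
          gcongr
      _ = _ := by ring
  have : 0 < c₀ * s⁻¹ := by positivity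
  rw [div_eq_mul_inv]
  linarith

theorem exp_neg_le_inv {x : ℝ} (hx : 0 < x) : Real.exp (-x) ≤ x⁻¹ := by
  rw [Real.exp_neg]
  exact inv_anti₀ hx (by linarith [Real.add_one_le_exp x])

/-- The torsion degenerates as `α` tends to `1`, so dividing by it is avoided: here `c ≤ 8 c₀/s²` is
integrable. The constant 16 only matches the other case. -/
theorem norm_sub_le_of_half_le {c₀ α : ℝ} (hc₀ : 0 < c₀) (h1 : 1 / 2 ≤ α)
    {m n b : ℝ → E3} (h : IsFrenetFrame (selfSimilarCurvature c₀ α) (selfSimilarTorsion α) m n b)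
    {s t : ℝ} (hs : 1 ≤ s) (hst : s ≤ t) : ‖m t - m s‖ ≤ 16 * c₀ / s := by
  have key := norm_sub_le_sub_of_hasDerivAt (f := m) (B := fun u => -(8 * c₀ * u⁻¹))
    (B' := fun u => 8 * c₀ * (u ^ 2)⁻¹) hst (fun u _ => h.deriv_m u)
    (fun u hu => (((hasDerivAt_inv (show u ≠ 0 by linarith [hu.1])).const_mul
      (8 * c₀)).neg).congr_deriv (by ring)) (fun u hu => by
      have hu0 : 0 < u := by linarith [hu.1]
      rw [norm_smul, (h.isMovingFrame.norm_eq_one u).2.1, mul_one, Real.norm_eq_abs,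
        selfSimilarCurvature, abs_of_nonneg (by positivity)]
      have : Real.exp (-(α * u ^ 2 / 4)) ≤ 8 * (u ^ 2)⁻¹ := by
        calc Real.exp (-(α * u ^ 2 / 4)) ≤ Real.exp (-(u ^ 2 / 8)) :=
              Real.exp_le_exp.2 (by nlinarith [sq_nonneg u])
          _ ≤ (u ^ 2 / 8)⁻¹ := exp_neg_le_inv (by positivity)
          _ = _ := by rw [inv_div, div_eq_mul_inv]
      nlinarith)
  have hs0 : 0 < s := by linarith
  have ht0 : 0 < t := by linarith
  have i1 : 0 < c₀ * s⁻¹ := by positivity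
  have i2 : 0 < c₀ * t⁻¹ := by positivity
  rw [div_eq_mul_inv]
  linarith

theorem norm_profile_sub_le {c₀ α : ℝ} (hc₀ : 0 < c₀) (h0 : 0 ≤ α) {s t : ℝ} (hs : 1 ≤ s)
    (hst : s ≤ t) : ‖profile c₀ α t - profile c₀ α s‖ ≤ 16 * c₀ / s := by
  obtain ⟨n, b, h⟩ := profile_spec c₀ α
  rcases le_total α (1 / 2) with h1 | h1
  · exact norm_sub_le_of_le_half hc₀ h0 h1 h hs hst
  · exact norm_sub_le_of_half_le hc₀ h1 h hs hst

theorem tendsto_profile {c₀ α : ℝ} (hc₀ : 0 < c₀) (h0 : 0 ≤ α) :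
    Tendsto (profile c₀ α) atTop (𝓝 (limitVector c₀ α)) := by
  refine CauchySeq.tendsto_limUnder (Metric.cauchySeq_iff'.2 fun ε hε => ?_)
  refine ⟨max 1 (32 * c₀ / ε), fun t ht => ?_⟩
  rw [dist_eq_norm]
  refine (norm_profile_sub_le hc₀ h0 (le_max_left _ _) ht).trans_lt ?_
  have h1 := le_max_right 1 (32 * c₀ / ε)
  rw [div_le_iff₀ hε] at h1
  rw [div_lt_iff₀ (lt_of_lt_of_le one_pos (le_max_left _ _))]
  linarith

theorem norm_limitVector {c₀ α : ℝ} (hc₀ : 0 < c₀) (h0 : 0 ≤ α) : ‖limitVector c₀ α‖ = 1 := by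
  obtain ⟨n, b, h⟩ := profile_spec c₀ α
  refine tendsto_nhds_unique (tendsto_profile hc₀ h0).norm (tendsto_const_nhds.congr fun s => ?_)
  exact (h.isMovingFrame.norm_eq_one s).1.symm

theorem norm_limitVector_sub_profile_le {c₀ α : ℝ} (hc₀ : 0 < c₀) (h0 : 0 ≤ α) {s : ℝ}
    (hs : 1 ≤ s) : ‖limitVector c₀ α - profile c₀ α s‖ ≤ 16 * c₀ / s :=
  le_of_tendsto ((tendsto_profile hc₀ h0).sub_const _).norm
    (eventually_atTop.2 ⟨s, fun _ ht => norm_profile_sub_le hc₀ h0 hs ht⟩)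

/-! ### Dependence on `α` away from `0` -/

/-- The majorant is a multiple of the derivative of `arctan`. In `exp y ≥ 1 + y + y²/2` with `y = α₀
s²/4`, the summands `4/α₀` and `32/α₀²` turn `y` into `s²` and `y²/2` into `s⁴`. -/
theorem sq_mul_exp_neg_le {α₀ : ℝ} (h0 : 0 < α₀) (s : ℝ) :
    s ^ 2 * Real.exp (-(α₀ * s ^ 2 / 4)) ≤ (4 / α₀ + 32 / α₀ ^ 2) * (1 / (1 + s ^ 2)) := by
  have hy : 0 ≤ α₀ * s ^ 2 / 4 := by positivity
  have h1 := Real.quadratic_le_exp_of_nonneg hy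
  rw [Real.exp_neg, ← div_eq_mul_inv, mul_one_div,
    div_le_div_iff₀ (Real.exp_pos _) (by positivity)]
  calc s ^ 2 * (1 + s ^ 2)
      ≤ (4 / α₀ + 32 / α₀ ^ 2) * (1 + α₀ * s ^ 2 / 4 + (α₀ * s ^ 2 / 4) ^ 2 / 2) := by
        have : (4 / α₀ + 32 / α₀ ^ 2) * (1 + α₀ * s ^ 2 / 4 + (α₀ * s ^ 2 / 4) ^ 2 / 2)
          = s ^ 2 * (1 + s ^ 2) + (4 / α₀ + 32 / α₀ ^ 2 + 8 * s ^ 2 / α₀ + α₀ * s ^ 4 / 8) := by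
          field_simp
          ring
        rw [this]
        have : 0 ≤ 4 / α₀ + 32 / α₀ ^ 2 + 8 * s ^ 2 / α₀ + α₀ * s ^ 4 / 8 := by positivity
        linarith
    _ ≤ _ := by gcongr

theorem abs_exp_neg_sub_exp_neg_le {z x y : ℝ} (hx : z ≤ x) (hy : z ≤ y) :
    |Real.exp (-x) - Real.exp (-y)| ≤ |x - y| * Real.exp (-z) := by
  wlog hxy : x ≤ y generalizing x y
  · rw [abs_sub_comm, abs_sub_comm x]
    exact this hy hx (le_of_not_ge hxy)
  rw [abs_of_nonneg (by simpa using hxy), abs_of_nonpos (by linarith)]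
  have h1 : Real.exp (-y) = Real.exp (-x) * Real.exp (x - y) := by
    rw [← Real.exp_add]
    congr 1
    ring
  have h2 := Real.add_one_le_exp (x - y)
  have h3 : Real.exp (-x) ≤ Real.exp (-z) := Real.exp_le_exp.2 (by linarith)
  rw [h1]
  nlinarith [Real.exp_pos (-x)]

theorem norm_limitVector_sub_le {c₀ α₀ : ℝ} (hc₀ : 0 < c₀) (h0 : 0 < α₀) {α α' : ℝ} (h : α₀ ≤ α)
    (h' : α₀ ≤ α') : ‖limitVector c₀ α - limitVector c₀ α'‖ ≤
      2 * c₀ * (4 / α₀ + 32 / α₀ ^ 2) * (|α - α'| + |√(1 - α ^ 2) - √(1 - α' ^ 2)|) := by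
  set K := 4 / α₀ + 32 / α₀ ^ 2 with hK
  set Δ := |α - α'| + |√(1 - α ^ 2) - √(1 - α' ^ 2)| with hΔ
  obtain ⟨n, b, hf⟩ := profile_spec c₀ α
  obtain ⟨n', b', hf'⟩ := profile_spec c₀ α'
  have dθ : ∀ γ s : ℝ, HasDerivAt (fun s => √(1 - γ ^ 2) * s ^ 2 / 4) (selfSimilarTorsion γ s) s :=
    fun γ s => (((hasDerivAt_pow 2 s).const_mul _).div_const 4).congr_deriv (by
      simp only [selfSimilarTorsion]
      push_cast
      ring)
  -- Without the rotation the torsions differ by a multiple of `s`, which is not integrable;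
  -- rotated, the phase difference `O(s²)` is multiplied by the decaying curvature.
  have r := hf.rotate (dθ α) (by simp)
  have r' := hf'.rotate (dθ α') (by simp)
  refine le_of_tendsto ((tendsto_profile hc₀ (h0.le.trans h)).sub
    (tendsto_profile hc₀ (h0.le.trans h'))).norm (eventually_atTop.2 ⟨0, fun T hT => ?_⟩)
  have key := (r.norm_sub_le r' (B := fun s => c₀ * K * Δ * Real.arctan s) hT
    (fun t _ => (Real.hasDerivAt_arctan t).const_mul _) (fun t _ => ?_)).1
  · refine key.trans ?_
    have : Real.arctan T ≤ 2 := (Real.arctan_lt_pi_div_two T).le.trans (by linarith [Real.pi_le_four])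
    have hp : 0 ≤ c₀ * K * Δ := by positivity
    simp only [Real.arctan_zero, mul_zero, sub_zero]
    nlinarith
  · set E := Real.exp (-(α₀ * t ^ 2 / 4)) with hE
    have e1 : |selfSimilarCurvature c₀ α t - selfSimilarCurvature c₀ α' t|
        ≤ c₀ * (|α - α'| * (t ^ 2 / 4) * E) := by
      simp only [selfSimilarCurvature]
      rw [← mul_sub, abs_mul, abs_of_pos hc₀]
      gcongr
      refine (abs_exp_neg_sub_exp_neg_le (z := α₀ * t ^ 2 / 4) (by gcongr) (by gcongr)).trans ?_
      rw [show α * t ^ 2 / 4 - α' * t ^ 2 / 4 = (α - α') * (t ^ 2 / 4) by ring, abs_mul,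
        abs_of_nonneg (show 0 ≤ t ^ 2 / 4 by positivity)]
    have c' : |selfSimilarCurvature c₀ α' t| ≤ c₀ * E := by
      rw [selfSimilarCurvature, abs_of_pos (by positivity), hE]
      gcongr
    have e2 : |√(1 - α ^ 2) * t ^ 2 / 4 - √(1 - α' ^ 2) * t ^ 2 / 4|
        = |√(1 - α ^ 2) - √(1 - α' ^ 2)| * (t ^ 2 / 4) := by
      rw [show √(1 - α ^ 2) * t ^ 2 / 4 - √(1 - α' ^ 2) * t ^ 2 / 4
        = (√(1 - α ^ 2) - √(1 - α' ^ 2)) * (t ^ 2 / 4) by ring, abs_mul,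
        abs_of_nonneg (show 0 ≤ t ^ 2 / 4 by positivity)]
    have mixed : ∀ (x y u v : ℝ), |u| ≤ 1 → |x * u - y * v| ≤ |x - y| + |y| * |u - v| := by
      intro x y u v hu
      calc |x * u - y * v| = |(x - y) * u + y * (u - v)| := by ring_nf
        _ ≤ |x - y| * |u| + |y| * |u - v| := by
          rw [← abs_mul, ← abs_mul]
          exact abs_add_le _ _
        _ ≤ _ := by
          gcongr
          exact mul_le_of_le_one_right (abs_nonneg _) hu
    set x := √(1 - α ^ 2) * t ^ 2 / 4
    set y := √(1 - α' ^ 2) * t ^ 2 / 4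
    have m1 := mixed (selfSimilarCurvature c₀ α t) (selfSimilarCurvature c₀ α' t) _ (Real.cos y)
      (Real.abs_cos_le_one x)
    have m2 := mixed (selfSimilarCurvature c₀ α t) (selfSimilarCurvature c₀ α' t) _ (Real.sin y)
      (Real.abs_sin_le_one x)
    have l1 : |Real.cos x - Real.cos y| ≤ |x - y| := by
      simpa [Real.dist_eq] using Real.lipschitzWith_cos.dist_le_mul x y
    have l2 : |Real.sin x - Real.sin y| ≤ |x - y| := by
      simpa [Real.dist_eq] using Real.lipschitzWith_sin.dist_le_mul x y
    have p1 := mul_le_mul c' l1 (abs_nonneg _) (by positivity)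
    have p2 := mul_le_mul c' l2 (abs_nonneg _) (by positivity)
    rw [e2] at p1 p2
    have fin := mul_le_mul_of_nonneg_left (sq_mul_exp_neg_le h0 t) (show 0 ≤ c₀ * Δ by positivity)
    simp only [Pi.zero_apply, sub_self, abs_zero, add_zero]
    rw [← hK, ← hE] at fin
    -- The 4 is the factor 2 of `norm_sub_le` times the two coefficients, cosine and sine.
    have expand : c₀ * Δ * (t ^ 2 * E) = 4 * (c₀ * (|α - α'| * (t ^ 2 / 4) * E)
        + c₀ * E * (|√(1 - α ^ 2) - √(1 - α' ^ 2)| * (t ^ 2 / 4))) := by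
      rw [hΔ]
      ring
    linarith

/-! ### Dependence on `α` near `0`

Two integrations by parts produce a combination `m + f b - g n` whose derivative is small. -/

/-- The coefficient `c / τ` of `b` in the corrected tangent. -/
noncomputable def binormalCoeff (c₀ α s : ℝ) : ℝ :=
  2 * c₀ / √(1 - α ^ 2) * (Real.exp (-(α * s ^ 2 / 4)) * s⁻¹)

/-- The coefficient `(c / τ)' / τ` of `-n` in the corrected tangent. -/
noncomputable def normalCoeff (c₀ α s : ℝ) : ℝ :=
  -(4 * c₀ / (1 - α ^ 2) * (Real.exp (-(α * s ^ 2 / 4)) * (s⁻¹ ^ 3 + α / 2 * s⁻¹)))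

/-- The derivative of `normalCoeff`. -/
noncomputable def normalWeight (c₀ α s : ℝ) : ℝ :=
  4 * c₀ / (1 - α ^ 2) * (Real.exp (-(α * s ^ 2 / 4)) * (3 * s⁻¹ ^ 4 + α * s⁻¹ ^ 2 + α ^ 2 / 4))

/-- The product `(c / τ) (c / τ)'`. -/
noncomputable def tangentWeight (c₀ α s : ℝ) : ℝ :=
  -(4 * c₀ ^ 2 / (1 - α ^ 2) * (Real.exp (-(α * s ^ 2 / 4)) ^ 2 * (s⁻¹ ^ 3 + α / 2 * s⁻¹)))

/-- The corrected tangent `m + f b - g n`. -/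
noncomputable def correctedTangent (c₀ α : ℝ) (m n b : ℝ → E3) (s : ℝ) : E3 :=
  m s + binormalCoeff c₀ α s • b s - normalCoeff c₀ α s • n s

/-- With `c = f τ` and `f' = g τ`, the terms `c n - f τ n` and `f' b - g τ b` cancel, leaving `g c m
- g' n`. -/
theorem hasDerivAt_correctedTangent {c₀ α : ℝ} (h0 : 0 ≤ α) (h1 : α ≤ 1 / 2) {m n b : ℝ → E3}
    (h : IsFrenetFrame (selfSimilarCurvature c₀ α) (selfSimilarTorsion α) m n b) {s : ℝ}
    (hs : 0 < s) : HasDerivAt (correctedTangent c₀ α m n b)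
      (tangentWeight c₀ α s • m s - normalWeight c₀ α s • n s) s := by
  have hβ := half_le_sqrt_one_sub_sq h0 h1
  have hβ2 : √(1 - α ^ 2) ^ 2 = 1 - α ^ 2 := Real.sq_sqrt (by nlinarith)
  have de := hasDerivAt_exp_neg_sq α s
  have di := hasDerivAt_inv hs.ne'
  have hE := Real.exp_pos (-(α * s ^ 2 / 4))
  set β := √(1 - α ^ 2) with hβdef
  have hβ0 : 0 < β := by linarith
  have df : HasDerivAt (binormalCoeff c₀ α) (normalCoeff c₀ α s * selfSimilarTorsion α s) s := by
    refine ((de.mul di).const_mul (2 * c₀ / β)).congr_deriv ?_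
    simp only [normalCoeff, selfSimilarTorsion, ← hβdef]
    rw [← hβ2]
    field_simp
    ring
  have dg : HasDerivAt (normalCoeff c₀ α) (normalWeight c₀ α s) s := by
    refine ((de.mul ((di.pow 3).add (di.const_mul (α / 2)))).const_mul
      (4 * c₀ / (1 - α ^ 2))).neg.congr_deriv ?_
    simp only [normalWeight, ← hβ2]
    simp
    field_simp
    ring
  have hc : selfSimilarCurvature c₀ α s = binormalCoeff c₀ α s * selfSimilarTorsion α s := by
    simp only [selfSimilarCurvature, binormalCoeff, selfSimilarTorsion, ← hβdef]
    field_simp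
  have hw : tangentWeight c₀ α s = normalCoeff c₀ α s * selfSimilarCurvature c₀ α s := by
    simp only [tangentWeight, normalCoeff, selfSimilarCurvature]
    ring
  refine (((h.deriv_m s).add (df.smul (h.deriv_b s))).sub
    (dg.smul (h.deriv_n s))).congr_deriv ?_
  rw [hw, hc]
  module

/-! ### Size of the coefficients and their `O(α)` variation. -/

section Estimates

variable {c₀ α s : ℝ}

theorem abs_sqrt_one_sub_sq_sub_one_le (h0 : 0 ≤ α) (h1 : α ≤ 1 / 2) :
    |√(1 - α ^ 2) - 1| ≤ α := by
  have h2 : √(1 - α ^ 2) ≤ 1 := Real.sqrt_le_one.2 (by nlinarith)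
  have h3 : 1 - α ≤ √(1 - α ^ 2) := Real.le_sqrt_of_sq_le (by nlinarith)
  rw [abs_of_nonpos (by linarith)]
  linarith

theorem inv_one_sub_sq_bounds (h0 : 0 ≤ α) (h1 : α ≤ 1 / 2) :
    1 ≤ 1 / (1 - α ^ 2) ∧ 1 / (1 - α ^ 2) ≤ 1 + α ∧ 1 / (1 - α ^ 2) ≤ 2 := by
  have h2 : 0 < 1 - α ^ 2 := by nlinarith
  refine ⟨?_, ?_, ?_⟩
  · rw [le_div_iff₀ h2]; nlinarith
  · rw [div_le_iff₀ h2]; nlinarith [mul_nonneg h0 (mul_nonneg h0 h0)]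
  · rw [div_le_iff₀ h2]; nlinarith

theorem one_sub_exp_neg_sq_le (α s : ℝ) :
    1 - α * s ^ 2 / 4 ≤ Real.exp (-(α * s ^ 2 / 4)) := by
  linarith [Real.add_one_le_exp (-(α * s ^ 2 / 4))]

/-- Here `k` stands for `1/(1 - α²)`. The growth `s²` is harmless because the weights multiply this
difference by `s⁻³` or `s⁻⁴`. -/
theorem abs_mul_exp_neg_sq_sub_one_le (h0 : 0 ≤ α) (hs : 1 ≤ s) {k : ℝ}
    (hk : 1 ≤ k) (hk' : k ≤ 1 + α) : |k * Real.exp (-(α * s ^ 2 / 4)) - 1| ≤ 2 * (α * s ^ 2) ∧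
      |k * Real.exp (-(α * s ^ 2 / 4)) ^ 2 - 1| ≤ 2 * (α * s ^ 2) := by
  have e1 := one_sub_exp_neg_sq_le α s
  have e2 := exp_neg_sq_le_one h0 s
  have e3 := Real.exp_pos (-(α * s ^ 2 / 4))
  set E := Real.exp (-(α * s ^ 2 / 4))
  have as : α ≤ α * s ^ 2 := le_mul_of_one_le_right h0 (by nlinarith)
  have e4 : 1 - α * s ^ 2 / 2 ≤ E ^ 2 := by nlinarith [sq_nonneg (1 - E)]
  have e5 : E ^ 2 ≤ 1 := by nlinarith
  refine ⟨abs_le.2 ⟨by nlinarith, by nlinarith⟩, abs_le.2 ⟨by nlinarith, by nlinarith⟩⟩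

theorem abs_tangentWeight_sub_le (h0 : 0 ≤ α) (h1 : α ≤ 1 / 2) (hs : 1 ≤ s) :
    |tangentWeight c₀ α s - tangentWeight c₀ 0 s| ≤ 12 * c₀ ^ 2 * α := by
  obtain ⟨k1, k2, k3⟩ := inv_one_sub_sq_bounds h0 h1
  have b1 := (abs_mul_exp_neg_sq_sub_one_le h0 hs k1 k2).2
  have e2 := exp_neg_sq_le_one h0 s
  have e3 := Real.exp_pos (-(α * s ^ 2 / 4))
  have hx : s * s⁻¹ = 1 := mul_inv_cancel₀ (by linarith)
  have hx0 : 0 < s⁻¹ := by positivity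
  have hx1 : s⁻¹ ≤ 1 := inv_le_one_of_one_le₀ hs
  simp only [tangentWeight]
  set k := 1 / (1 - α ^ 2) with hk
  set E := Real.exp (-(α * s ^ 2 / 4))
  set x := s⁻¹
  rw [show -(4 * c₀ ^ 2 / (1 - α ^ 2) * (E ^ 2 * (x ^ 3 + α / 2 * x))) -
      -(4 * c₀ ^ 2 / (1 - 0 ^ 2) * (Real.exp (-(0 * s ^ 2 / 4)) ^ 2 * (x ^ 3 + 0 / 2 * x)))
      = -(4 * c₀ ^ 2) * ((k * E ^ 2 - 1) * x ^ 3 + k * E ^ 2 * (α / 2 * x)) by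
        rw [hk]; simp; ring, abs_mul, abs_neg, abs_of_nonneg (by positivity)]
  have t1 : |(k * E ^ 2 - 1) * x ^ 3| ≤ 2 * α := by
    rw [abs_mul, abs_of_pos (by positivity : 0 < x ^ 3)]
    calc _ ≤ 2 * (α * s ^ 2) * x ^ 3 := by gcongr
      _ = 2 * α * ((s * x) ^ 2 * x) := by ring
      _ ≤ 2 * α := by rw [hx]; nlinarith
  have t2 : |k * E ^ 2 * (α / 2 * x)| ≤ α := by
    rw [abs_of_nonneg (by positivity)]
    calc _ ≤ 2 * 1 ^ 2 * (α / 2 * 1) := by gcongr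
      _ = α := by ring
  have := abs_add_le ((k * E ^ 2 - 1) * x ^ 3) (k * E ^ 2 * (α / 2 * x))
  nlinarith [sq_nonneg c₀]

theorem abs_normalWeight_sub_le (hc₀ : 0 ≤ c₀) (h0 : 0 ≤ α) (h1 : α ≤ 1 / 2) (hs : 1 ≤ s) :
    |normalWeight c₀ α s - normalWeight c₀ 0 s| ≤ 40 * c₀ * α := by
  obtain ⟨k1, k2, k3⟩ := inv_one_sub_sq_bounds h0 h1
  have b1 := (abs_mul_exp_neg_sq_sub_one_le h0 hs k1 k2).1
  have e2 := exp_neg_sq_le_one h0 s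
  have e3 := Real.exp_pos (-(α * s ^ 2 / 4))
  have hx : s * s⁻¹ = 1 := mul_inv_cancel₀ (by linarith)
  have hx0 : 0 < s⁻¹ := by positivity
  have hx1 : s⁻¹ ≤ 1 := inv_le_one_of_one_le₀ hs
  simp only [normalWeight]
  set k := 1 / (1 - α ^ 2) with hk
  set E := Real.exp (-(α * s ^ 2 / 4))
  set x := s⁻¹
  rw [show 4 * c₀ / (1 - α ^ 2) * (E * (3 * x ^ 4 + α * x ^ 2 + α ^ 2 / 4)) -
      4 * c₀ / (1 - 0 ^ 2) * (Real.exp (-(0 * s ^ 2 / 4)) * (3 * x ^ 4 + 0 * x ^ 2 + 0 ^ 2 / 4))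
      = (4 * c₀) * (3 * ((k * E - 1) * x ^ 4) + k * E * (α * x ^ 2 + α ^ 2 / 4)) by
        rw [hk]; simp; ring, abs_mul, abs_of_nonneg (by positivity)]
  have t1 : |3 * ((k * E - 1) * x ^ 4)| ≤ 6 * α := by
    rw [abs_mul, abs_mul, abs_of_pos (by positivity : 0 < x ^ 4), abs_of_pos three_pos]
    have : x ^ 2 ≤ 1 := by nlinarith
    calc _ ≤ 3 * (2 * (α * s ^ 2) * x ^ 4) := by gcongr
      _ = 6 * α * ((s * x) ^ 2 * x ^ 2) := by ring
      _ ≤ 6 * α := by rw [hx]; nlinarith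
  have t2 : |k * E * (α * x ^ 2 + α ^ 2 / 4)| ≤ 4 * α := by
    rw [abs_of_nonneg (by positivity)]
    calc _ ≤ 2 * 1 * (α * 1 ^ 2 + α ^ 2 / 4) := by gcongr
      _ ≤ 4 * α := by nlinarith
  have := abs_add_le (3 * ((k * E - 1) * x ^ 4)) (k * E * (α * x ^ 2 + α ^ 2 / 4))
  nlinarith

theorem abs_tangentWeight_zero_le (hs : 1 ≤ s) : |tangentWeight c₀ 0 s| ≤ 4 * c₀ ^ 2 * s⁻¹ ^ 3 := by
  simp [tangentWeight, abs_mul, abs_of_pos (show 0 < s by linarith)]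

/-- The true decay `s⁻⁴` is weakened to `s⁻³`, which is exactly what compensates the `s³` of
`frame_sub_zero_le`. -/
theorem abs_normalWeight_zero_le (hc₀ : 0 ≤ c₀) (hs : 1 ≤ s) :
    |normalWeight c₀ 0 s| ≤ 12 * c₀ * s⁻¹ ^ 3 := by
  have hx0 : 0 < s⁻¹ := by positivity
  have hx1 : s⁻¹ ^ 4 ≤ s⁻¹ ^ 3 :=
    pow_le_pow_of_le_one hx0.le (inv_le_one_of_one_le₀ hs) (by norm_num)
  rw [show normalWeight c₀ 0 s = 12 * c₀ * s⁻¹ ^ 4 by simp [normalWeight]; ring,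
    abs_of_nonneg (by positivity)]
  gcongr

theorem abs_binormalCoeff_le (hc₀ : 0 ≤ c₀) (h0 : 0 ≤ α) (h1 : α ≤ 1 / 2) (hs : 1 ≤ s) :
    |binormalCoeff c₀ α s| ≤ 4 * c₀ * s⁻¹ := by
  have hβ := half_le_sqrt_one_sub_sq h0 h1
  have hβ0 : 0 < √(1 - α ^ 2) := by linarith
  have i1 : 2 * c₀ / √(1 - α ^ 2) ≤ 4 * c₀ := by rw [div_le_iff₀ hβ0]; nlinarith
  rw [binormalCoeff, abs_of_nonneg (by positivity)]
  calc _ ≤ 4 * c₀ * (1 * s⁻¹) := by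
        gcongr
        exact exp_neg_sq_le_one h0 s
    _ = _ := by ring

theorem abs_normalCoeff_le (hc₀ : 0 ≤ c₀) (h0 : 0 ≤ α) (h1 : α ≤ 1 / 2) (hs : 1 ≤ s) :
    |normalCoeff c₀ α s| ≤ 16 * c₀ * s⁻¹ := by
  obtain ⟨k1, k2, k3⟩ := inv_one_sub_sq_bounds h0 h1
  have hx0 : 0 < s⁻¹ := by positivity
  have hx1 : s⁻¹ ^ 3 ≤ s⁻¹ ^ 1 :=
    pow_le_pow_of_le_one hx0.le (inv_le_one_of_one_le₀ hs) (by norm_num)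
  have e2 := exp_neg_sq_le_one h0 s
  rw [normalCoeff, abs_neg, show 4 * c₀ / (1 - α ^ 2) = 4 * c₀ * (1 / (1 - α ^ 2)) by ring,
    abs_of_nonneg (by positivity)]
  calc _ ≤ 4 * c₀ * 2 * (1 * (s⁻¹ ^ 1 + 1 * s⁻¹)) := by
        gcongr
        linarith
    _ = _ := by ring

theorem abs_binormalCoeff_one_sub_le (hc₀ : 0 ≤ c₀) (h0 : 0 ≤ α) (h1 : α ≤ 1 / 2) :
    |binormalCoeff c₀ α 1 - binormalCoeff c₀ 0 1| ≤ 8 * c₀ * α := by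
  have hβ := half_le_sqrt_one_sub_sq h0 h1
  have hβ' := abs_le.1 (abs_sqrt_one_sub_sq_sub_one_le h0 h1)
  have hβ1 : √(1 - α ^ 2) ≤ 1 := Real.sqrt_le_one.2 (by nlinarith)
  have e1 := one_sub_exp_neg_sq_le α 1
  have e2 := exp_neg_sq_le_one h0 1
  set E := Real.exp (-(α * 1 ^ 2 / 4))
  have hβ0 : 0 < √(1 - α ^ 2) := by linarith
  rw [show binormalCoeff c₀ α 1 - binormalCoeff c₀ 0 1
    = 2 * c₀ * (E / √(1 - α ^ 2) - 1) by simp [binormalCoeff, E]; ring, abs_mul,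
    abs_of_nonneg (by positivity)]
  have : |E / √(1 - α ^ 2) - 1| ≤ 4 * α := by
    rw [abs_le, le_sub_iff_add_le, sub_le_iff_le_add, le_div_iff₀ hβ0, div_le_iff₀ hβ0]
    constructor <;> nlinarith
  nlinarith

theorem abs_normalCoeff_one_sub_le (hc₀ : 0 ≤ c₀) (h0 : 0 ≤ α) (h1 : α ≤ 1 / 2) :
    |normalCoeff c₀ α 1 - normalCoeff c₀ 0 1| ≤ 12 * c₀ * α := by
  obtain ⟨k1, k2, k3⟩ := inv_one_sub_sq_bounds h0 h1
  have b1 := (abs_mul_exp_neg_sq_sub_one_le h0 le_rfl k1 k2).1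
  have e2 := exp_neg_sq_le_one h0 1
  have e3 := Real.exp_pos (-(α * 1 ^ 2 / 4))
  set E := Real.exp (-(α * 1 ^ 2 / 4)) with hE
  set k := 1 / (1 - α ^ 2) with hk
  rw [show normalCoeff c₀ α 1 - normalCoeff c₀ 0 1 = -(4 * c₀) * ((k * E - 1) + k * E * (α / 2)) by
    simp [normalCoeff, hE, hk]; ring, abs_mul, abs_neg, abs_of_nonneg (by positivity)]
  have t2 : |k * E * (α / 2)| ≤ α := by
    rw [abs_of_nonneg (by positivity)]
    calc _ ≤ 2 * 1 * (α / 2) := by gcongr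
      _ = α := by ring
  have := abs_add_le (k * E - 1) (k * E * (α / 2))
  nlinarith

end Estimates

/-! ### Comparison of the parameters `α` and `0`. -/

/-- The crude comparison of the frames with parameters `α` and `0`. -/
theorem frame_sub_zero_le {c₀ α : ℝ} (hc₀ : 0 ≤ c₀) (h0 : 0 ≤ α) (h1 : α ≤ 1 / 2)
    {m n b m' n' b' : ℝ → E3}
    (h : IsFrenetFrame (selfSimilarCurvature c₀ α) (selfSimilarTorsion α) m n b)
    (h' : IsFrenetFrame (selfSimilarCurvature c₀ 0) (selfSimilarTorsion 0) m' n' b')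
    {s : ℝ} (hs : 1 ≤ s) : ‖m s - m' s‖ ≤ (c₀ + 1) * α * s ^ 3 ∧
      ‖n s - n' s‖ ≤ (c₀ + 1) * α * s ^ 3 ∧ ‖b s - b' s‖ ≤ (c₀ + 1) * α * s ^ 3 := by
  have key := h.isMovingFrame.norm_sub_le h'.isMovingFrame (T := s)
    (B := fun s => c₀ * α / 6 * s ^ 3 + α / 2 * s ^ 2)
    (B' := fun s => c₀ * α / 2 * s ^ 2 + α * s) (by linarith)
    (fun t _ => (((hasDerivAt_pow 3 t).const_mul _).add
      ((hasDerivAt_pow 2 t).const_mul _)).congr_deriv (by push_cast; ring)) (fun t ht => by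
      have e1 := one_sub_exp_neg_sq_le α t
      have e2 := exp_neg_sq_le_one h0 t
      have i1 : |selfSimilarCurvature c₀ α t - selfSimilarCurvature c₀ 0 t|
          ≤ c₀ * (α * t ^ 2 / 4) := by
        rw [show selfSimilarCurvature c₀ α t - selfSimilarCurvature c₀ 0 t
          = c₀ * (Real.exp (-(α * t ^ 2 / 4)) - 1) by simp [selfSimilarCurvature]; ring, abs_mul,
          abs_of_nonneg hc₀, abs_of_nonpos (by linarith)]
        gcongr
        linarith
      have i2 : |selfSimilarTorsion α t - selfSimilarTorsion 0 t| ≤ α * (t / 2) := by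
        rw [show selfSimilarTorsion α t - selfSimilarTorsion 0 t
          = (√(1 - α ^ 2) - 1) * (t / 2) by simp [selfSimilarTorsion]; ring, abs_mul,
          abs_of_nonneg (by linarith [ht.1] : 0 ≤ t / 2)]
        have := ht.1
        gcongr
        exact abs_sqrt_one_sub_sq_sub_one_le h0 h1
      simp only [Pi.zero_apply, sub_self, abs_zero, add_zero]
      linarith)
  have : c₀ * α / 6 * s ^ 3 + α / 2 * s ^ 2 - (c₀ * α / 6 * 0 ^ 3 + α / 2 * 0 ^ 2)
      ≤ (c₀ + 1) * α * s ^ 3 := by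
    have i1 : α * s ^ 2 ≤ α * s ^ 3 := by gcongr; norm_num
    have i2 : 0 ≤ α * s ^ 2 := by positivity
    have i3 : 0 ≤ c₀ * (α * s ^ 3) := by positivity
    nlinarith
  exact ⟨key.1.trans this, key.2.1.trans this, key.2.2.trans this⟩

theorem norm_limitVector_sub_zero_le {c₀ : ℝ} (hc₀ : 0 < c₀) : ∃ K : ℝ, 0 < K ∧
    ∀ α ∈ Ioc (0 : ℝ) (1 / 2), ‖limitVector c₀ α - limitVector c₀ 0‖ ≤ K * √α := by
  -- `W α` bounds the speed at which the corrected tangents separate, `V α` their distance at `s =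
  -- 1`. In `72 c₀`, `40 c₀` pays for the corrections at `s = 1/√α` and `32 c₀` for the two tails.
  set W := 12 * c₀ ^ 2 + 40 * c₀ + (4 * c₀ ^ 2 + 12 * c₀) * (c₀ + 1) with hW
  set V := (1 + 20 * c₀) * (c₀ + 1) + 20 * c₀ with hV
  refine ⟨V + W + 72 * c₀, by positivity, fun α hα => ?_⟩
  obtain ⟨hα0, h1⟩ := hα
  have h0 := hα0.le
  obtain ⟨n, b, h⟩ := profile_spec c₀ α
  obtain ⟨n', b', h'⟩ := profile_spec c₀ 0
  set m := profile c₀ α with hm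
  set m' := profile c₀ 0 with hm'
  set r := √α with hr
  have hr0 : 0 < r := Real.sqrt_pos.2 hα0
  have hrα : r ^ 2 = α := Real.sq_sqrt h0
  have hr1 : r ≤ 1 := by nlinarith
  have hS : 1 ≤ r⁻¹ := (one_le_inv₀ hr0).2 hr1
  have hz : (0 : ℝ) ≤ 1 / 2 := by norm_num
  have nrm := h.isMovingFrame.norm_eq_one
  have nrm' := h'.isMovingFrame.norm_eq_one
  have key := norm_sub_le_sub_of_hasDerivAt
    (f := fun u => correctedTangent c₀ α m n b u - correctedTangent c₀ 0 m' n' b' u)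
    (B := fun u => W * α * u) (B' := fun _ => W * α) hS
    (fun u hu => (hasDerivAt_correctedTangent h0 h1 h (by linarith [hu.1])).sub
      (hasDerivAt_correctedTangent le_rfl hz h' (by linarith [hu.1])))
    (fun u _ => ((hasDerivAt_id u).const_mul _).congr_deriv (mul_one _)) (fun u hu => by
      obtain ⟨d1, d2, -⟩ := frame_sub_zero_le hc₀.le h0 h1 h h' hu.1
      have w1 := abs_tangentWeight_sub_le (c₀ := c₀) h0 h1 hu.1
      have w2 := abs_normalWeight_sub_le hc₀.le h0 h1 hu.1
      have w3 := abs_tangentWeight_zero_le (c₀ := c₀) hu.1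
      have w4 := abs_normalWeight_zero_le hc₀.le hu.1
      have hu0 : 0 < u := by linarith [hu.1]
      have hux : u⁻¹ ^ 3 * u ^ 3 = 1 := by
        rw [← mul_pow, inv_mul_cancel₀ hu0.ne', one_pow]
      have p3 := mul_le_mul w3 d1 (norm_nonneg _) (by positivity)
      have p4 := mul_le_mul w4 d2 (norm_nonneg _) (by positivity)
      calc _ = ‖(tangentWeight c₀ α u - tangentWeight c₀ 0 u) • m u
              + tangentWeight c₀ 0 u • (m u - m' u)
              - (normalWeight c₀ α u - normalWeight c₀ 0 u) • n u
              - normalWeight c₀ 0 u • (n u - n' u)‖ := by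
            congr 1
            module
        _ ≤ |tangentWeight c₀ α u - tangentWeight c₀ 0 u| * 1
              + |tangentWeight c₀ 0 u| * ‖m u - m' u‖
              + |normalWeight c₀ α u - normalWeight c₀ 0 u| * 1
              + |normalWeight c₀ 0 u| * ‖n u - n' u‖ := by
            -- The two factors 1 are turned into `‖m u‖` and `‖n u‖`, so that every summand is the
            -- norm of a scalar multiple.
            conv_rhs => rw [← (nrm u).1]
            conv_rhs => enter [1, 2, 2]; rw [(nrm u).1, ← (nrm u).2.1]
            simp only [← Real.norm_eq_abs, ← norm_smul]
            refine (norm_sub_le _ _).trans ?_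
            gcongr
            refine (norm_sub_le _ _).trans ?_
            gcongr
            exact norm_add_le _ _
        _ ≤ 12 * c₀ ^ 2 * α * 1 + 4 * c₀ ^ 2 * u⁻¹ ^ 3 * ((c₀ + 1) * α * u ^ 3)
              + 40 * c₀ * α * 1 + 12 * c₀ * u⁻¹ ^ 3 * ((c₀ + 1) * α * u ^ 3) := by gcongr
        _ = 12 * c₀ ^ 2 * α + 40 * c₀ * α
              + (4 * c₀ ^ 2 + 12 * c₀) * (c₀ + 1) * α * (u⁻¹ ^ 3 * u ^ 3) := by ring
        _ = W * α := by rw [hux, hW]; ring)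
  have atOne : ‖correctedTangent c₀ α m n b 1 - correctedTangent c₀ 0 m' n' b' 1‖ ≤ V * α := by
    obtain ⟨d1, d2, d3⟩ := frame_sub_zero_le hc₀.le h0 h1 h h' le_rfl
    have w1 := abs_binormalCoeff_le hc₀.le h0 h1 le_rfl
    have w2 := abs_normalCoeff_le hc₀.le h0 h1 le_rfl
    have w3 := abs_binormalCoeff_one_sub_le hc₀.le h0 h1
    have w4 := abs_normalCoeff_one_sub_le hc₀.le h0 h1
    simp only [inv_one, one_pow, mul_one] at d1 d2 d3 w1 w2
    calc _ = ‖(m 1 - m' 1) + binormalCoeff c₀ α 1 • (b 1 - b' 1)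
            + (binormalCoeff c₀ α 1 - binormalCoeff c₀ 0 1) • b' 1
            - normalCoeff c₀ α 1 • (n 1 - n' 1)
            - (normalCoeff c₀ α 1 - normalCoeff c₀ 0 1) • n' 1‖ := by
          congr 1
          simp only [correctedTangent]
          module
      _ ≤ ‖m 1 - m' 1‖ + ‖binormalCoeff c₀ α 1 • (b 1 - b' 1)‖
            + ‖(binormalCoeff c₀ α 1 - binormalCoeff c₀ 0 1) • b' 1‖
            + ‖normalCoeff c₀ α 1 • (n 1 - n' 1)‖
            + ‖(normalCoeff c₀ α 1 - normalCoeff c₀ 0 1) • n' 1‖ := by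
          refine (norm_sub_le _ _).trans ?_
          gcongr
          refine (norm_sub_le _ _).trans ?_
          gcongr
          exact norm_add₃_le
      _ ≤ (c₀ + 1) * α + 4 * c₀ * ((c₀ + 1) * α) + 8 * c₀ * α * 1
            + 16 * c₀ * ((c₀ + 1) * α) + 12 * c₀ * α * 1 := by
          simp only [norm_smul, Real.norm_eq_abs, (nrm' 1).2.1, (nrm' 1).2.2]
          gcongr
      _ = V * α := by rw [hV]; ring
  have hαr : α ≤ r := by nlinarith
  have hαS : α * r⁻¹ = r := by rw [← hrα]; field_simp
  have atEnd : ‖m r⁻¹ - m' r⁻¹‖ ≤ (V + W + 40 * c₀) * r := by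
    have w1 := abs_binormalCoeff_le hc₀.le h0 h1 hS
    have w2 := abs_normalCoeff_le hc₀.le h0 h1 hS
    have w3 := abs_binormalCoeff_le hc₀.le le_rfl hz hS
    have w4 := abs_normalCoeff_le hc₀.le le_rfl hz hS
    rw [inv_inv] at w1 w2 w3 w4
    have fin : ‖correctedTangent c₀ α m n b r⁻¹ - correctedTangent c₀ 0 m' n' b' r⁻¹‖
        ≤ (V + W) * r := by
      have t1 := norm_le_norm_add_norm_sub'
        (correctedTangent c₀ α m n b r⁻¹ - correctedTangent c₀ 0 m' n' b' r⁻¹)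
        (correctedTangent c₀ α m n b 1 - correctedTangent c₀ 0 m' n' b' 1)
      have t2 : W * α * r⁻¹ = W * r := by rw [mul_assoc, hαS]
      have t3 : V * α ≤ V * r := by gcongr
      have t4 : 0 ≤ W * α := by positivity
      linarith
    calc _ = ‖(correctedTangent c₀ α m n b r⁻¹ - correctedTangent c₀ 0 m' n' b' r⁻¹)
            - binormalCoeff c₀ α r⁻¹ • b r⁻¹ + normalCoeff c₀ α r⁻¹ • n r⁻¹
            + binormalCoeff c₀ 0 r⁻¹ • b' r⁻¹ - normalCoeff c₀ 0 r⁻¹ • n' r⁻¹‖ := by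
          congr 1
          simp only [correctedTangent]
          module
      _ ≤ ‖correctedTangent c₀ α m n b r⁻¹ - correctedTangent c₀ 0 m' n' b' r⁻¹‖
            + ‖binormalCoeff c₀ α r⁻¹ • b r⁻¹‖ + ‖normalCoeff c₀ α r⁻¹ • n r⁻¹‖
            + ‖binormalCoeff c₀ 0 r⁻¹ • b' r⁻¹‖ + ‖normalCoeff c₀ 0 r⁻¹ • n' r⁻¹‖ := by
          refine (norm_sub_le _ _).trans ?_
          gcongr
          refine norm_add₃_le.trans ?_
          gcongr
          exact norm_sub_le _ _
      _ ≤ (V + W) * r + 4 * c₀ * r * 1 + 16 * c₀ * r * 1 + 4 * c₀ * r * 1 + 16 * c₀ * r * 1 := by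
          simp only [norm_smul, Real.norm_eq_abs, (nrm _).2.1, (nrm _).2.2, (nrm' _).2.1,
            (nrm' _).2.2]
          gcongr
      _ = _ := by ring
  have l1 := norm_limitVector_sub_profile_le hc₀ h0 hS
  have l2 := norm_limitVector_sub_profile_le hc₀ le_rfl hS
  rw [div_inv_eq_mul] at l1 l2
  calc ‖limitVector c₀ α - limitVector c₀ 0‖
      = ‖(limitVector c₀ α - m r⁻¹) + (m r⁻¹ - m' r⁻¹) - (limitVector c₀ 0 - m' r⁻¹)‖ := by
        congr 1
        module
    _ ≤ ‖limitVector c₀ α - m r⁻¹‖ + ‖m r⁻¹ - m' r⁻¹‖ + ‖limitVector c₀ 0 - m' r⁻¹‖ :=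
        (norm_sub_le _ _).trans (by gcongr; exact norm_add_le _ _)
    _ ≤ 16 * c₀ * r + (V + W + 40 * c₀) * r + 16 * c₀ * r := by gcongr
    _ = _ := by ring

/-! ### Continuity, the rate at `α = 1`, and the conclusion. -/

theorem continuousOn_limitVector {c₀ : ℝ} (hc₀ : 0 < c₀) :
    ContinuousOn (fun α => limitVector c₀ α) (Icc (0 : ℝ) 1) := by
  intro α hα
  rcases hα.1.eq_or_lt with h0 | h0
  · subst h0
    obtain ⟨K, hK, hle⟩ := norm_limitVector_sub_zero_le hc₀
    refine tendsto_iff_norm_sub_tendsto_zero.2 (squeeze_zero' (g := fun x => K * √x)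
      (Eventually.of_forall fun _ => norm_nonneg _) ?_ ?_)
    · filter_upwards [self_mem_nhdsWithin,
        mem_nhdsWithin_of_mem_nhds (Iio_mem_nhds (show (0 : ℝ) < 1 / 2 by norm_num))] with x hx hx'
      rcases hx.1.eq_or_lt with h | h
      · simp [← h]
      · exact hle x ⟨h, le_of_lt hx'⟩
    · have : Continuous fun x => K * √x := by fun_prop
      simpa using (this.tendsto 0).mono_left nhdsWithin_le_nhds
  -- The lower bound `α/2` holds near `α`. A two-sided neighbourhood is allowed even at `α = 1`,
  -- since for `x > 1` the root `√(1 - x²)` is `0` by convention.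
  · refine ContinuousAt.continuousWithinAt (tendsto_iff_norm_sub_tendsto_zero.2
      (squeeze_zero' (g := fun x => 2 * c₀ * (4 / (α / 2) + 32 / (α / 2) ^ 2) *
        (|x - α| + |√(1 - x ^ 2) - √(1 - α ^ 2)|))
      (Eventually.of_forall fun _ => norm_nonneg _) ?_ ?_))
    · filter_upwards [Ioi_mem_nhds (half_lt_self h0)] with x hx
      exact norm_limitVector_sub_le hc₀ (half_pos h0) (le_of_lt hx) (by linarith)
    · have : Continuous fun x => 2 * c₀ * (4 / (α / 2) + 32 / (α / 2) ^ 2) *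
        (|x - α| + |√(1 - x ^ 2) - √(1 - α ^ 2)|) := by fun_prop
      simpa using this.tendsto α

theorem norm_limitVector_sub_one_le {c₀ α : ℝ} (hc₀ : 0 < c₀) (hα : α ∈ Icc (1 / 2 : ℝ) 1) :
    ‖limitVector c₀ α - limitVector c₀ 1‖ ≤ 1000 * c₀ * √(1 - α) := by
  have h := norm_limitVector_sub_le hc₀ (half_pos one_pos) hα.1 (by norm_num : (1 / 2 : ℝ) ≤ 1)
  have hx : 0 ≤ 1 - α := by linarith [hα.2]
  have s1 := Real.sq_sqrt hx
  have s0 := Real.sqrt_nonneg (1 - α)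
  have i1 : |α - 1| ≤ √(1 - α) := by
    rw [abs_of_nonpos (by linarith)]
    nlinarith [hα.1]
  -- With `α₀ = 1/2` the constant is `272 c₀`; together with `i1` this gives `816 c₀ √(1 - α)`,
  -- rounded up to `1000 c₀`.
  have i2 : √(1 - α ^ 2) ≤ 2 * √(1 - α) := by
    refine (Real.sqrt_le_left (by positivity)).2 ?_
    nlinarith [hα.1]
  rw [show (1 : ℝ) - 1 ^ 2 = 0 by norm_num, Real.sqrt_zero, sub_zero,
    abs_of_nonneg (Real.sqrt_nonneg _)] at h
  refine h.trans ?_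
  norm_num
  nlinarith

theorem theorem4 (c₀ : ℝ) (hc₀ : 0 < c₀) :
    (∀ α ∈ Set.Icc (0 : ℝ) 1,
      Filter.Tendsto (profile c₀ α) Filter.atTop (nhds (limitVector c₀ α)) ∧
        ‖limitVector c₀ α‖ = 1) ∧
    ContinuousOn (fun α => limitVector c₀ α) (Set.Icc (0 : ℝ) 1) ∧
    ∃ C : ℝ, 0 < C ∧
      (∀ α ∈ Set.Ioc (0 : ℝ) (1 / 2),
        ‖limitVector c₀ α - limitVector c₀ 0‖ ≤ C * (Real.sqrt α * |Real.log α|)) ∧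
      (∀ α ∈ Set.Icc (1 / 2 : ℝ) 1,
        ‖limitVector c₀ α - limitVector c₀ 1‖ ≤ C * Real.sqrt (1 - α)) := by
  obtain ⟨K, hK, hle⟩ := norm_limitVector_sub_zero_le hc₀
  have hlog := Real.log_pos one_lt_two
  refine ⟨fun α hα => ⟨tendsto_profile hc₀ hα.1, norm_limitVector hc₀ hα.1⟩,
    continuousOn_limitVector hc₀, K / Real.log 2 + 1000 * c₀, by positivity, fun α hα => ?_,
    fun α hα => ?_⟩
  -- The logarithm is bounded below on `(0, 1/2]`, so it can be inserted at the cost of `1 / log 2`.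
  · have h1 : Real.log 2 ≤ |Real.log α| := by
      have := Real.log_le_log hα.1 hα.2
      rw [one_div, Real.log_inv] at this
      rw [abs_of_nonpos (by linarith)]
      linarith
    calc _ ≤ K * √α := hle α hα
      _ = K / Real.log 2 * (√α * Real.log 2) := by field_simp
      _ ≤ (K / Real.log 2 + 1000 * c₀) * (√α * |Real.log α|) := by
        gcongr
        linarith
  · refine (norm_limitVector_sub_one_le hc₀ hα).trans ?_
    gcongr
    have : 0 < K / Real.log 2 := by positivity
    linarith
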